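/- Let $(M^m,g)$ and $(N^n,h)$ be smooth Riemannian manifolds (without boundary) with $m\neq 2$, let $f:M\to(0,\infty)$ be a smooth function, let $\varphi:M\to N$ be a smooth map, and put $\bar g=f^{2/(m-2)}g$. The map $\varphi:(M,g)\to(N,h)$ is called $f$-harmonic if it is a critical point of the $f$-energy $$E_f(\varphi)=\tfrac12\int_\Omega f\,|d\varphi|^2\,dv_g$$ for every compact domain $\Omega\subseteq M$, that is, $\frac{d}{dt}\big|_{t=0}E_f(\varphi_t)=0$ for every smooth variation $\varphi_t$ of $\varphi=\varphi_0$ with $\varphi_t=\varphi$ outside $\Omega$; it is called harmonic if the same holds for the energy $E(\varphi)=\frac12\int_\Omega|d\varphi|^2\,dv_g$. Let $\tau(\varphi,g)=\mathrm{Tr}_g\nabla d\varphi$ be the tension field, and $\tau_f(\varphi,g)=f\,\tau(\varphi,g)+d\varphi(\mathrm{grad}_g f)$ the $f$-tension field, so that $\tau(\varphi,g)=0$ and $\tau_f(\varphi,g)=0$ are the harmonic map equation and the $f$-harmonic map equation. Then: (1) $\varphi:(M,g)\to(N,h)$ is $f$-harmonic if and only if $\varphi:(M,\bar g)\to(N,h)$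 is harmonic; (2) $\tau(\varphi,\bar g)=f^{-m/(m-2)}\,\tau_f(\varphi,g)$ at every point of $M$; (3) in particular, $\tau_f(\varphi,g)=0$ on $M$ if and only if $\tau(\varphi,\bar g)=0$ on $M$. -/

import Mathlib

open scoped Manifold ContDiff Topology
open MeasureTheory

noncomputable section

/-- A smooth Riemannian metric on the `m`-dimensional manifold (without boundary) `M`. -/
abbrev SmoothMetric (m : ℕ) (M : Type*) [TopologicalSpace M]
    [ChartedSpace (EuclideanSpace ℝ (Fin m)) M] [IsManifold (𝓡 m) ∞ M] :=
  Bundle.ContMDiffRiemannianMetric (𝓡 m) ∞ (EuclideanSpace ℝ (Fin m))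
    (fun x : M => TangentSpace (𝓡 m) x)

namespace FHarmonic

/-! ### Linear algebra and calculus in coordinates -/

/-- The `i`-th standard basis vector of `ℝᵐ`. -/
def stdVec {m : ℕ} (i : Fin m) : EuclideanSpace ℝ (Fin m) := EuclideanSpace.single i 1

/-- The partial derivative `∂ᵢ u (z)`. -/
def pderiv {m : ℕ} (i : Fin m) (u : EuclideanSpace ℝ (Fin m) → ℝ)
    (z : EuclideanSpace ℝ (Fin m)) : ℝ :=
  fderiv ℝ u z (stdVec i)

section Domain

variable {m : ℕ} {M : Type*} [TopologicalSpace M] [ChartedSpace (EuclideanSpace ℝ (Fin m)) M]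
  [IsManifold (𝓡 m) ∞ M]

/-- The `i`-th coordinate vector `∂ᵢ` at `x` of the preferred chart around `x`. (The tangent space
at `x` is identified with `ℝᵐ` by means of that chart.) -/
def coordVec (x : M) (i : Fin m) : TangentSpace (𝓡 m) x := stdVec i

/-- The Gram matrix `(g_{ij})` of the metric at `x`, in the basis `coordVec x` of `T_x M`. -/
def gram (g : SmoothMetric m M) (x : M) : Matrix (Fin m) (Fin m) ℝ :=
  Matrix.of fun i j => g.inner x (coordVec x i) (coordVec x j)

/-- The `g`-trace `g^{ij} B_{ij}` at `x` of a family of coefficients `B_{ij}`, with values in a real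
vector space, relative to the basis `coordVec x`. -/
def metricTrace (g : SmoothMetric m M) (x : M) {V : Type*} [AddCommGroup V] [Module ℝ V]
    (B : Fin m → Fin m → V) : V :=
  ∑ i, ∑ j, (gram g x)⁻¹ i j • B i j

/-- The gradient of `f`, with components `g^{ij} ∂_j f`. -/
def grad (g : SmoothMetric m M) (f : M → ℝ) (x : M) : TangentSpace (𝓡 m) x :=
  metricTrace g x fun i j => mvfderiv (𝓡 m) f x (coordVec x j) • coordVec x i

/-- The coefficient functions `g_{ij}` of the metric in the preferred chart around `p`, as
functions of the coordinates `z ∈ ℝᵐ` (meaningful for `z` in the range of the chart). -/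
def chartGram (g : SmoothMetric m M) (p : M) (z : EuclideanSpace ℝ (Fin m)) :
    Matrix (Fin m) (Fin m) ℝ :=
  Matrix.of fun i j =>
    g.inner ((extChartAt (𝓡 m) p).symm z)
      (mfderiv 𝓘(ℝ, EuclideanSpace ℝ (Fin m)) (𝓡 m) (extChartAt (𝓡 m) p).symm z (stdVec i))
      (mfderiv 𝓘(ℝ, EuclideanSpace ℝ (Fin m)) (𝓡 m) (extChartAt (𝓡 m) p).symm z (stdVec j))

/-- The Christoffel symbols `Γᵏᵢⱼ = ½ gᵏˡ (∂ᵢ gⱼₗ + ∂ⱼ gᵢₗ - ∂ₗ gᵢⱼ)` of the Levi-Civita connection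
in the preferred chart around `p`, as functions of the coordinates `z`. -/
def christoffel (g : SmoothMetric m M) (p : M) (z : EuclideanSpace ℝ (Fin m))
    (k i j : Fin m) : ℝ :=
  (1 / 2) * ∑ l, (chartGram g p z)⁻¹ k l *
    (pderiv i (fun y => chartGram g p y j l) z + pderiv j (fun y => chartGram g p y i l) z
      - pderiv l (fun y => chartGram g p y i j) z)

/-- The metric `f ^ a • g` on `M`, for a positive smooth function `f` and a real exponent `a`. -/
def conformalMetric (g : SmoothMetric m M) (f : M → ℝ)
    (hf : ContMDiff (𝓡 m) 𝓘(ℝ, ℝ) ∞ f) (hpos : ∀ x, 0 < f x) (a : ℝ) : SmoothMetric m M where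
  inner x := (f x ^ a) • g.inner x
  symm x v w := by
    have h := g.symm x v w
    simp only [smul_apply, h]
  pos x v hv := by
    have h := g.pos x v hv
    simp only [smul_apply, smul_eq_mul]
    exact mul_pos (Real.rpow_pos_of_pos (hpos x) a) h
  isVonNBounded x := by
    have hc : 0 < f x ^ a := Real.rpow_pos_of_pos (hpos x) a
    have hs : 0 < Real.sqrt (f x ^ a) := Real.sqrt_pos.2 hc
    have hb := (g.isVonNBounded x).image
      ((Real.sqrt (f x ^ a))⁻¹ • ContinuousLinearMap.id ℝ (TangentSpace (𝓡 m) x))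
    refine hb.subset ?_
    intro v hv
    refine ⟨Real.sqrt (f x ^ a) • v, ?_, ?_⟩
    · simp only [Set.mem_ofPred_eq, smul_apply, smul_eq_mul] at hv
      simp only [Set.mem_ofPred_eq, map_smul, smul_apply, smul_eq_mul]
      rw [← mul_assoc, Real.mul_self_sqrt hc.le]
      exact hv
    · simp only [smul_apply, ContinuousLinearMap.id_apply]
      rw [smul_smul, inv_mul_cancel₀ hs.ne', one_smul]
  contMDiff := by
    have hfa : ContMDiff (𝓡 m) 𝓘(ℝ, ℝ) ∞ (fun x => f x ^ a) := by
      intro x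
      have h1 : ContDiffAt ℝ ∞ (fun t : ℝ => t ^ a) (f x) :=
        Real.contDiffAt_rpow_const_of_ne (hpos x).ne'
      exact h1.contMDiffAt.comp x (hf x)
    exact ContMDiff.smul_section hfa g.contMDiff

/-! ### The Riemannian volume measure -/

theorem exists_chart_sequence (m : ℕ) (M : Type*) [TopologicalSpace M]
    [ChartedSpace (EuclideanSpace ℝ (Fin m)) M] [SecondCountableTopology M] [Nonempty M] :
    ∃ p : ℕ → M, ⋃ k, (chartAt (EuclideanSpace ℝ (Fin m)) (p k)).source = Set.univ := by
  obtain ⟨s, hs, hcov⟩ := TopologicalSpace.countable_cover_nhds (fun x : M =>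
    (chartAt (EuclideanSpace ℝ (Fin m)) x).open_source.mem_nhds (mem_chart_source _ x))
  have hne : s.Nonempty := by
    by_contra h0
    rw [Set.not_nonempty_iff_eq_empty] at h0
    subst h0
    simp only [Set.mem_empty_iff_false, Set.iUnion_of_empty, Set.iUnion_empty] at hcov
    exact Set.empty_ne_univ hcov
  obtain ⟨p, hp⟩ := hs.exists_eq_range hne
  refine ⟨p, ?_⟩
  rw [← hcov, hp, Set.biUnion_range]

variable [MeasurableSpace M]

/-- The measure `√(det (g_{ij})) dz¹ ⋯ dzᵐ` of the preferred chart around `p`, transported to the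
domain of that chart. -/
def chartVolume (g : SmoothMetric m M) (p : M) : Measure M :=
  Measure.map (extChartAt (𝓡 m) p).symm
    ((volume.restrict (extChartAt (𝓡 m) p).target).withDensity
      fun z => ENNReal.ofReal (Real.sqrt (chartGram g p z).det))

open Classical in
/-- The Riemannian volume measure `dv_g`: `M` is cut into countably many disjoint Borel pieces, each
of them inside the domain of a chart, and on each piece the measure is `√(det (g_{ij})) dz` in that
chart. (By the change of variables formula the result does not depend on the pieces.) -/
def riemannianVolume [SecondCountableTopology M] (g : SmoothMetric m M) : Measure M :=
  if _ : Nonempty M then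
    Measure.sum fun k : ℕ =>
      (chartVolume g ((exists_chart_sequence m M).choose k)).restrict
        (disjointed (fun j => (chartAt (EuclideanSpace ℝ (Fin m))
          ((exists_chart_sequence m M).choose j)).source) k)
  else 0

end Domain

section Maps

variable {m n : ℕ}
  {M : Type*} [TopologicalSpace M] [ChartedSpace (EuclideanSpace ℝ (Fin m)) M]
  [IsManifold (𝓡 m) ∞ M]
  {N : Type*} [TopologicalSpace N] [ChartedSpace (EuclideanSpace ℝ (Fin n)) N]
  [IsManifold (𝓡 n) ∞ N]

/-! ### Tension fields -/

/-- The components `φ^α` of `φ` in the preferred charts around `x` and `φ x`. -/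
def coordMap (φ : M → N) (x : M) (α : Fin n) (z : EuclideanSpace ℝ (Fin m)) : ℝ :=
  writtenInExtChartAt (𝓡 m) (𝓡 n) x φ z α

/-- The value at `x` of the second fundamental form `∇dφ (∂ᵢ, ∂ⱼ)`, a vector in `T_{φ x} N`. With
respect to the preferred charts around `x` and `φ x` its components are
`∂ᵢ∂ⱼ φ^α - Γᵏᵢⱼ ∂ₖ φ^α + Γ^α_{βγ} ∂ᵢ φ^β ∂ⱼ φ^γ`. -/
def secondFundamentalForm (g : SmoothMetric m M) (h : SmoothMetric n N) (φ : M → N) (x : M)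
    (i j : Fin m) : TangentSpace (𝓡 n) (φ x) :=
  let z := extChartAt (𝓡 m) x x
  let w := extChartAt (𝓡 n) (φ x) (φ x)
  ∑ α, (pderiv i (pderiv j (coordMap φ x α)) z
      - ∑ k, christoffel g x z k i j * pderiv k (coordMap φ x α) z
      + ∑ β, ∑ γ, christoffel h (φ x) w α β γ
          * pderiv i (coordMap φ x β) z * pderiv j (coordMap φ x γ) z) • coordVec (φ x) α

/-- The tension field `τ(φ) = Tr_g ∇dφ`. -/
def tensionField (g : SmoothMetric m M) (h : SmoothMetric n N) (φ : M → N) (x : M) :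
    TangentSpace (𝓡 n) (φ x) :=
  metricTrace g x (secondFundamentalForm g h φ x)

/-- The `f`-tension field `τ_f(φ) = f τ(φ) + dφ(grad f)`. -/
def fTensionField (f : M → ℝ) (g : SmoothMetric m M) (h : SmoothMetric n N) (φ : M → N) (x : M) :
    TangentSpace (𝓡 n) (φ x) :=
  f x • tensionField g h φ x + mfderiv (𝓡 m) (𝓡 n) φ x (grad g f x)

/-! ### Energies and their critical points -/

/-- The squared norm `|dφ|² = g^{ij} h(dφ(∂ᵢ), dφ(∂ⱼ))` at `x`. -/
def normSqDiff (g : SmoothMetric m M) (h : SmoothMetric n N) (φ : M → N) (x : M) : ℝ :=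
  metricTrace g x fun i j =>
    h.inner (φ x) (mfderiv (𝓡 m) (𝓡 n) φ x (coordVec x i))
      (mfderiv (𝓡 m) (𝓡 n) φ x (coordVec x j))

/-- The energy `E(φ) = ½ ∫_Ω |dφ|² dv_g`. -/
def energy [SecondCountableTopology M] [MeasurableSpace M]
    (g : SmoothMetric m M) (h : SmoothMetric n N) (φ : M → N) (Ω : Set M) : ℝ :=
  (1 / 2) * ∫ x in Ω, normSqDiff g h φ x ∂(riemannianVolume g)

/-- The `f`-energy `E_f(φ) = ½ ∫_Ω f |dφ|² dv_g`. -/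
def fEnergy [SecondCountableTopology M] [MeasurableSpace M] (f : M → ℝ)
    (g : SmoothMetric m M) (h : SmoothMetric n N) (φ : M → N) (Ω : Set M) : ℝ :=
  (1 / 2) * ∫ x in Ω, f x * normSqDiff g h φ x ∂(riemannianVolume g)

/-- A compact domain: a compact set that is the closure of its interior. -/
def IsCompactDomain (Ω : Set M) : Prop :=
  IsCompact Ω ∧ closure (interior Ω) = Ω

/-- `Φ` is, for parameters `|t| < ε`, a smooth variation of `φ` supported in `Ω`. -/
structure IsVariation (m n : ℕ) {M : Type*} [TopologicalSpace M]
    [ChartedSpace (EuclideanSpace ℝ (Fin m)) M]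
    {N : Type*} [TopologicalSpace N] [ChartedSpace (EuclideanSpace ℝ (Fin n)) N]
    (φ : M → N) (Ω : Set M) (ε : ℝ) (Φ : ℝ → M → N) : Prop where
  contMDiffOn : ContMDiffOn (𝓘(ℝ, ℝ).prod (𝓡 m)) (𝓡 n) ∞ (fun q : ℝ × M => Φ q.1 q.2)
    (Set.Ioo (-ε) ε ×ˢ Set.univ)
  zero : Φ 0 = φ
  eq_outside : ∀ t ∈ Set.Ioo (-ε) ε, ∀ x ∉ Ω, Φ t x = φ x

/-- `φ` is a critical point of the functional `ℰ · Ω` for every compact domain `Ω`, with respect to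
smooth variations of `φ` supported in `Ω`. -/
def IsCriticalOnCompactDomains (m n : ℕ) {M : Type*} [TopologicalSpace M]
    [ChartedSpace (EuclideanSpace ℝ (Fin m)) M]
    {N : Type*} [TopologicalSpace N] [ChartedSpace (EuclideanSpace ℝ (Fin n)) N]
    (ℰ : (M → N) → Set M → ℝ) (φ : M → N) : Prop :=
  ∀ Ω : Set M, IsCompactDomain Ω → ∀ ε > 0, ∀ Φ : ℝ → M → N, IsVariation m n φ Ω ε Φ →
    HasDerivAt (fun t => ℰ (Φ t) Ω) 0 0

/-- Harmonic maps: critical points of the energy. -/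
def IsHarmonicMap [SecondCountableTopology M] [MeasurableSpace M]
    (g : SmoothMetric m M) (h : SmoothMetric n N) (φ : M → N) : Prop :=
  IsCriticalOnCompactDomains m n (energy g h) φ

/-- `f`-harmonic maps: critical points of the `f`-energy. -/
def IsFHarmonicMap [SecondCountableTopology M] [MeasurableSpace M] (f : M → ℝ)
    (g : SmoothMetric m M) (h : SmoothMetric n N) (φ : M → N) : Prop :=
  IsCriticalOnCompactDomains m n (fEnergy f g h) φ

end Maps

end FHarmonic

end

open FHarmonic

namespace FHarmonic

/-! Write `a = 2 / (m - 2)`. Multiplying the metric by `f ^ a` multiplies the inverse metric by `f ^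
(-a)` and the volume by `f ^ (a * m / 2)`. Since `a * m / 2 - a = 1`, the two energies agree for
every map (`energy_conformalMetric`), so they have the same critical points; no first variation
formula is needed.

The tension fields are compared directly. The Levi-Civita connection changes by a tensor in `df`
(`christoffel_conformalMetric`), whose trace is `a (2 - m) / (2 f)` times `grad f`
(`metricTrace_christoffel_conformalMetric`). Only the domain connection changes, so `∇dφ` changes by
minus `dφ` of that tensor, and since `a (m - 2) = 2` its trace gains exactly `f⁻¹ dφ(grad f)`. -/

theorem sum_smul_coordVec {m : ℕ} {M : Type*} [TopologicalSpace M]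
    [ChartedSpace (EuclideanSpace ℝ (Fin m)) M] (x : M) (v : EuclideanSpace ℝ (Fin m)) :
    ∑ i, v i • coordVec x i = (v : TangentSpace (𝓡 m) x) := by
  have h := (EuclideanSpace.basisFun (Fin m) ℝ).sum_repr v
  simp only [EuclideanSpace.basisFun_repr, EuclideanSpace.basisFun_apply] at h
  exact h

/-! ### Gram matrices, traces and their conformal scaling. -/

section Domain

variable {m : ℕ} {M : Type*} [TopologicalSpace M] [ChartedSpace (EuclideanSpace ℝ (Fin m)) M]
  [IsManifold (𝓡 m) ∞ M]

/-- `T_x M` is identified with `ℝᵐ` through the preferred chart at `x` itself, so the derivative is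
the identity at this base point. This links `chartGram`, which is differentiated, to `gram`, which
is traced. -/
theorem mfderiv_extChartAt_symm_self (x : M) (v : EuclideanSpace ℝ (Fin m)) :
    mfderiv 𝓘(ℝ, EuclideanSpace ℝ (Fin m)) (𝓡 m) (extChartAt (𝓡 m) x).symm
      (extChartAt (𝓡 m) x x) v = v := by
  have h := mfderivWithin_range_extChartAt_symm (I := 𝓡 m) (x := x)
  rw [ModelWithCorners.range_eq_univ, mfderivWithin_univ] at h
  rw [h]
  rfl

theorem chartGram_self (g : SmoothMetric m M) (x : M) :
    chartGram g x (extChartAt (𝓡 m) x x) = gram g x := by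
  ext i j
  simp only [chartGram, gram, Matrix.of_apply, mfderiv_extChartAt_symm_self, coordVec]
  rw [extChartAt_to_inv x]

/-- The coordinate fields are the tangent map of the inverse chart applied to constant sections,
hence `C¹`, and the metric pairs them smoothly. This serves both the product rule for Christoffel
symbols and the measurability of the volume density. -/
theorem differentiableAt_chartGram (g : SmoothMetric m M) (p : M) {z : EuclideanSpace ℝ (Fin m)}
    (hz : z ∈ (extChartAt (𝓡 m) p).target) (i j : Fin m) :
    DifferentiableAt ℝ (fun y => chartGram g p y i j) z := by
  have hsymm : ContMDiffAt 𝓘(ℝ, EuclideanSpace ℝ (Fin m)) (𝓡 m) ∞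
      (extChartAt (𝓡 m) p).symm z :=
    (contMDiffOn_extChartAt_symm p).contMDiffAt ((isOpen_extChartAt_target p).mem_nhds hz)
  have hv : ∀ v : EuclideanSpace ℝ (Fin m),
      ContMDiffAt 𝓘(ℝ, EuclideanSpace ℝ (Fin m)) (𝓡 m).tangent 1
        (fun y => (⟨(extChartAt (𝓡 m) p).symm y,
          mfderiv 𝓘(ℝ, EuclideanSpace ℝ (Fin m)) (𝓡 m) (extChartAt (𝓡 m) p).symm y v⟩ :
            TangentBundle (𝓡 m) M)) z := by
    intro v
    have hsec : ContMDiffAt 𝓘(ℝ, EuclideanSpace ℝ (Fin m)) 𝓘(ℝ, EuclideanSpace ℝ (Fin m)).tangent 1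
        (fun y => (⟨y, v⟩ : TangentBundle 𝓘(ℝ, EuclideanSpace ℝ (Fin m))
          (EuclideanSpace ℝ (Fin m)))) z :=
      contMDiffAt_vectorSpace_iff_contDiffAt.2 contDiffAt_const
    have hopen := isOpen_extChartAt_target (I := 𝓡 m) p
    -- The tangent map loses one derivative, so `C²` for the inverse chart gives `C¹`.
    have hT := (((contMDiffOn_extChartAt_symm (n := ∞) (I := 𝓡 m) p).of_le
      ENat.LEInfty.out).contMDiffOn_tangentMapWithin
      (m := 1) (n := 2) (by norm_num [one_add_one_eq_two]) hopen.uniqueMDiffOn)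
    have hTz := hT.contMDiffAt (x := ⟨z, v⟩)
      ((hopen.preimage (FiberBundle.continuous_proj _ _)).mem_nhds hz)
    refine (hTz.comp z hsec).congr_of_eventuallyEq ?_
    filter_upwards [hopen.mem_nhds hz] with y hy
    simp only [Function.comp, tangentMapWithin, mfderivWithin_of_isOpen hopen hy]
  have hmd : ContMDiffAt 𝓘(ℝ, EuclideanSpace ℝ (Fin m))
      ((𝓡 m).prod 𝓘(ℝ, ℝ)) 1
      (fun y => Bundle.TotalSpace.mk' ℝ (E := Bundle.Trivial M ℝ) ((extChartAt (𝓡 m) p).symm y)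
        (g.inner ((extChartAt (𝓡 m) p).symm y)
          (mfderiv 𝓘(ℝ, EuclideanSpace ℝ (Fin m)) (𝓡 m) (extChartAt (𝓡 m) p).symm y (stdVec i))
          (mfderiv 𝓘(ℝ, EuclideanSpace ℝ (Fin m)) (𝓡 m) (extChartAt (𝓡 m) p).symm y
            (stdVec j)))) z := by
    apply ContMDiffAt.clm_bundle_apply₂ (F₁ := EuclideanSpace ℝ (Fin m))
      (F₂ := EuclideanSpace ℝ (Fin m))
    · exact (ContMDiffAt.comp z g.contMDiff.contMDiffAt hsymm).of_le (by exact_mod_cast le_top)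
    · exact hv _
    · exact hv _
  rw [Bundle.contMDiffAt_totalSpace] at hmd
  exact (contMDiffAt_iff_contDiffAt.1 hmd.2).differentiableAt one_ne_zero

theorem gram_mulVec_dotProduct (g : SmoothMetric m M) (x : M) (v : Fin m → ℝ) :
    v ⬝ᵥ (gram g x).mulVec v =
      g.inner x (∑ i, v i • coordVec x i) (∑ i, v i • coordVec x i) := by
  simp only [dotProduct, Matrix.mulVec, gram, Matrix.of_apply, map_sum, map_smul,
    _root_.sum_apply, _root_.smul_apply, smul_eq_mul, Finset.mul_sum]
  rw [Finset.sum_comm]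
  refine Finset.sum_congr rfl fun i _ => Finset.sum_congr rfl fun j _ => ?_
  ring

theorem gram_symm (g : SmoothMetric m M) (x : M) (i j : Fin m) : gram g x i j = gram g x j i :=
  g.symm x _ _

theorem gram_posDef (g : SmoothMetric m M) (x : M) : (gram g x).PosDef := by
  refine Matrix.PosDef.of_dotProduct_mulVec_pos ?_ fun v hv => ?_
  · ext i j
    exact gram_symm g x j i
  · rw [star_trivial, gram_mulVec_dotProduct]
    refine g.pos x _ ?_
    rw [sum_smul_coordVec x (WithLp.toLp 2 v)]
    intro h
    exact hv (congrArg (WithLp.ofLp) h)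

theorem gram_conformalMetric (g : SmoothMetric m M) (f : M → ℝ)
    (hf : ContMDiff (𝓡 m) 𝓘(ℝ, ℝ) ∞ f) (hpos : ∀ x, 0 < f x) (a : ℝ) (x : M) :
    gram (conformalMetric g f hf hpos a) x = (f x ^ a) • gram g x := rfl

theorem chartGram_conformalMetric (g : SmoothMetric m M) (f : M → ℝ)
    (hf : ContMDiff (𝓡 m) 𝓘(ℝ, ℝ) ∞ f) (hpos : ∀ x, 0 < f x) (a : ℝ) (p : M)
    (z : EuclideanSpace ℝ (Fin m)) :
    chartGram (conformalMetric g f hf hpos a) p z =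
      (f ((extChartAt (𝓡 m) p).symm z) ^ a) • chartGram g p z := rfl

theorem inv_gram_conformalMetric (g : SmoothMetric m M) (f : M → ℝ)
    (hf : ContMDiff (𝓡 m) 𝓘(ℝ, ℝ) ∞ f) (hpos : ∀ x, 0 < f x) (a : ℝ) (x : M) :
    (gram (conformalMetric g f hf hpos a) x)⁻¹ = (f x ^ a)⁻¹ • (gram g x)⁻¹ := by
  have hc : f x ^ a ≠ 0 := (Real.rpow_pos_of_pos (hpos x) a).ne'
  have := (gram_posDef g x).det_pos.ne'
  rw [gram_conformalMetric]
  exact Matrix.inv_smul' (gram g x) (Units.mk0 _ hc) (isUnit_iff_ne_zero.2 this)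

theorem metricTrace_conformalMetric (g : SmoothMetric m M) (f : M → ℝ)
    (hf : ContMDiff (𝓡 m) 𝓘(ℝ, ℝ) ∞ f) (hpos : ∀ x, 0 < f x) (a : ℝ) (x : M)
    {V : Type*} [AddCommGroup V] [Module ℝ V] (B : Fin m → Fin m → V) :
    metricTrace (conformalMetric g f hf hpos a) x B = (f x ^ a)⁻¹ • metricTrace g x B := by
  simp only [metricTrace, inv_gram_conformalMetric, Matrix.smul_apply, smul_assoc, Finset.smul_sum]

theorem metricTrace_sub (g : SmoothMetric m M) (x : M) {V : Type*} [AddCommGroup V] [Module ℝ V]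
    (B C : Fin m → Fin m → V) :
    metricTrace g x (fun i j => B i j - C i j) = metricTrace g x B - metricTrace g x C := by
  simp only [metricTrace, smul_sub, Finset.sum_sub_distrib]

theorem metricTrace_sum (g : SmoothMetric m M) (x : M) {V : Type*} [AddCommGroup V] [Module ℝ V]
    {ι : Type*} (s : Finset ι) (B : ι → Fin m → Fin m → V) :
    metricTrace g x (fun i j => ∑ k ∈ s, B k i j) = ∑ k ∈ s, metricTrace g x (B k) := by
  simp only [metricTrace, Finset.smul_sum]
  rw [Finset.sum_comm (s := s)]
  exact Finset.sum_congr rfl fun i _ => Finset.sum_comm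

theorem metricTrace_smul (g : SmoothMetric m M) (x : M) {V : Type*} [AddCommGroup V] [Module ℝ V]
    (b : Fin m → Fin m → ℝ) (v : V) :
    metricTrace g x (fun i j => b i j • v) = metricTrace g x b • v := by
  simp only [metricTrace, Finset.sum_smul, smul_assoc]

/-! ### Conformal scaling of the volume. -/

/-- Almost everywhere measurability is the right generality: the inverse chart is controlled only on
the chart's target. -/
theorem _root_.MeasureTheory.Measure.withDensity_map {α β : Type*} [MeasurableSpace α]
    [MeasurableSpace β] {μ : Measure α} {e : α → β} (he : AEMeasurable e μ) {ρ : β → ENNReal}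
    (hρ : Measurable ρ) :
    (μ.map e).withDensity ρ = (μ.withDensity (ρ ∘ e)).map e := by
  ext A hA
  have hpre : NullMeasurableSet (e ⁻¹' A) μ := he.nullMeasurableSet_preimage hA
  rw [withDensity_apply _ hA,
    Measure.map_apply_of_aemeasurable (he.mono_ac (withDensity_absolutelyContinuous _ _)) hA,
    withDensity_apply₀ _ hpre, Measure.restrict_map_of_aemeasurable he hA,
    lintegral_map' hρ.aemeasurable (he.mono_measure Measure.restrict_le_self)]
  rfl

/-- The determinant of an `m × m` matrix is homogeneous of degree `m`, and the square root halves
the exponent. The factor is a function on `M`, so it passes through the push-forward as a density.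
-/
theorem chartVolume_conformalMetric [MeasurableSpace M] [BorelSpace M] (g : SmoothMetric m M)
    (f : M → ℝ)
    (hf : ContMDiff (𝓡 m) 𝓘(ℝ, ℝ) ∞ f) (hpos : ∀ x, 0 < f x) (a : ℝ) (p : M) :
    chartVolume (conformalMetric g f hf hpos a) p =
      (chartVolume g p).withDensity (fun x => ENNReal.ofReal (f x ^ (a * m / 2))) := by
  have hρ : Measurable (fun x => ENNReal.ofReal (f x ^ (a * m / 2))) :=
    ((hf.continuous.measurable).pow_const _).ennreal_ofReal
  have hsymm : AEMeasurable (extChartAt (𝓡 m) p).symm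
      (volume.restrict (extChartAt (𝓡 m) p).target) :=
    (continuousOn_extChartAt_symm p).aemeasurable
      (isOpen_extChartAt_target p).measurableSet
  have hdet : ContinuousOn (fun z => (chartGram g p z).det) (extChartAt (𝓡 m) p).target := by
    simp only [Matrix.det_apply]
    exact continuousOn_finsetSum _ fun σ _ => (continuousOn_finsetProd _ fun i _ z hz =>
      (differentiableAt_chartGram g p hz _ _).continuousAt.continuousWithinAt).const_smul _
  have hd : AEMeasurable (fun z => ENNReal.ofReal (Real.sqrt (chartGram g p z).det))
      (volume.restrict (extChartAt (𝓡 m) p).target) :=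
    ((hdet.aemeasurable (isOpen_extChartAt_target p).measurableSet).sqrt).ennreal_ofReal
  unfold chartVolume
  rw [Measure.withDensity_map (hsymm.mono_ac (withDensity_absolutelyContinuous _ _)) hρ,
    ← withDensity_mul₀ hd (hρ.comp_aemeasurable hsymm)]
  congr 2
  funext z
  have hfz := hpos ((extChartAt (𝓡 m) p).symm z)
  rw [Pi.mul_apply, Function.comp_apply, ← ENNReal.ofReal_mul (Real.sqrt_nonneg _),
    chartGram_conformalMetric, Matrix.det_smul, Fintype.card_fin,
    Real.sqrt_mul (by positivity), mul_comm, Real.sqrt_eq_rpow (_ ^ m), ← Real.rpow_natCast,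
    ← Real.rpow_mul hfz.le, ← Real.rpow_mul hfz.le]
  ring_nf

/-- The cutting of `M` into pieces does not involve the metric and the density is the same function
on each piece, so independence of the pieces is not needed. -/
theorem riemannianVolume_conformalMetric [SecondCountableTopology M] [MeasurableSpace M]
    [BorelSpace M] (g : SmoothMetric m M) (f : M → ℝ)
    (hf : ContMDiff (𝓡 m) 𝓘(ℝ, ℝ) ∞ f) (hpos : ∀ x, 0 < f x) (a : ℝ) :
    riemannianVolume (conformalMetric g f hf hpos a) =
      (riemannianVolume g).withDensity (fun x => ENNReal.ofReal (f x ^ (a * m / 2))) := by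
  unfold riemannianVolume
  split_ifs with hM
  · rw [withDensity_sum]
    congr 1
    funext k
    rw [chartVolume_conformalMetric, restrict_withDensity]
    exact MeasurableSet.disjointed (fun j => (chartAt _ _).open_source.measurableSet) k
  · simp

end Domain
-- Differentials in the preferred charts.
/-- The partial derivatives of a function in the preferred chart are its derivatives along the
coordinate vectors. -/
theorem mvfderiv_coordVec {m : ℕ} {M : Type*} [TopologicalSpace M]
    [ChartedSpace (EuclideanSpace ℝ (Fin m)) M] {f : M → ℝ} {x : M} (hf : MDifferentiableAt (𝓡 m) 𝓘(ℝ, ℝ) f x)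
    (i : Fin m) :
    mvfderiv (𝓡 m) f x (coordVec x i) =
      pderiv i (f ∘ (extChartAt (𝓡 m) x).symm) (extChartAt (𝓡 m) x x) := by
  have h : mfderiv (𝓡 m) 𝓘(ℝ, ℝ) f x =
      fderiv ℝ (f ∘ (extChartAt (𝓡 m) x).symm) (extChartAt (𝓡 m) x x) := by
    rw [hf.mfderiv, ModelWithCorners.range_eq_univ, fderivWithin_univ]
    rfl
  have h' : mvfderiv (𝓡 m) f x (coordVec x i) = mfderiv (𝓡 m) 𝓘(ℝ, ℝ) f x (coordVec x i) := rfl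
  rw [h', h]
  rfl

theorem mfderiv_coordVec {m n : ℕ} {M : Type*} [TopologicalSpace M]
    [ChartedSpace (EuclideanSpace ℝ (Fin m)) M] {N : Type*} [TopologicalSpace N]
    [ChartedSpace (EuclideanSpace ℝ (Fin n)) N] {φ : M → N} {x : M} (hφ : MDifferentiableAt (𝓡 m) (𝓡 n) φ x)
    (i : Fin m) :
    mfderiv (𝓡 m) (𝓡 n) φ x (coordVec x i) =
      ∑ α, pderiv i (coordMap φ x α) (extChartAt (𝓡 m) x x) • coordVec (φ x) α := by
  have h : mfderiv (𝓡 m) (𝓡 n) φ x =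
      fderiv ℝ (writtenInExtChartAt (𝓡 m) (𝓡 n) x φ) (extChartAt (𝓡 m) x x) := by
    rw [hφ.mfderiv, ModelWithCorners.range_eq_univ, fderivWithin_univ]
  have hd : DifferentiableAt ℝ (writtenInExtChartAt (𝓡 m) (𝓡 n) x φ) (extChartAt (𝓡 m) x x) := by
    have := hφ.differentiableWithinAt_writtenInExtChartAt
    rwa [ModelWithCorners.range_eq_univ, differentiableWithinAt_univ] at this
  have hp : ∀ α, pderiv i (coordMap φ x α) (extChartAt (𝓡 m) x x) =
      (fderiv ℝ (writtenInExtChartAt (𝓡 m) (𝓡 n) x φ) (extChartAt (𝓡 m) x x) (stdVec i)) α := by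
    intro α
    have := ((EuclideanSpace.proj (𝕜 := ℝ) α).hasFDerivAt.comp _ hd.hasFDerivAt).fderiv
    exact congrArg (fun L => L (stdVec i)) this
  simp only [hp]
  rw [h]
  exact (sum_smul_coordVec (φ x) _).symm

/-! ### Energies and tension fields under a conformal change. -/

section Tension

variable {m n : ℕ}
  {M : Type*} [TopologicalSpace M] [ChartedSpace (EuclideanSpace ℝ (Fin m)) M]
  [IsManifold (𝓡 m) ∞ M]
  {N : Type*} [TopologicalSpace N] [ChartedSpace (EuclideanSpace ℝ (Fin n)) N]
  [IsManifold (𝓡 n) ∞ N]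

theorem energy_conformalMetric [SecondCountableTopology M] [MeasurableSpace M] [BorelSpace M]
    (hm : m ≠ 2) (g : SmoothMetric m M) (h : SmoothMetric n N) (f : M → ℝ)
    (hf : ContMDiff (𝓡 m) 𝓘(ℝ, ℝ) ∞ f) (hpos : ∀ x, 0 < f x) (φ : M → N) {Ω : Set M}
    (hΩ : MeasurableSet Ω) :
    energy (conformalMetric g f hf hpos (2 / ((m : ℝ) - 2))) h φ Ω = fEnergy f g h φ Ω := by
  have hm' : (m : ℝ) - 2 ≠ 0 := sub_ne_zero.2 (by exact_mod_cast hm)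
  unfold energy fEnergy
  rw [riemannianVolume_conformalMetric, restrict_withDensity hΩ,
    integral_withDensity_eq_integral_toReal_smul
      ((hf.continuous.measurable).pow_const _).ennreal_ofReal
      (Filter.Eventually.of_forall fun _ => ENNReal.ofReal_lt_top)]
  congr 2
  funext x
  have hfx := hpos x
  rw [normSqDiff, metricTrace_conformalMetric, ENNReal.toReal_ofReal (by positivity), smul_smul,
    ← Real.rpow_neg hfx.le, ← Real.rpow_add hfx]
  -- The first exponent comes from the volume, the second from the inverse metric; their sum is the
  -- single power of `f` in the `f`-energy.
  have : 2 / ((m : ℝ) - 2) * m / 2 + -(2 / ((m : ℝ) - 2)) = 1 := by field_simp; ring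
  rw [this, Real.rpow_one]
  rfl

/-- The second derivatives of `φ` and the terms in the connection of `N` do not see the domain
metric and cancel. -/
theorem secondFundamentalForm_eq_sub (g g' : SmoothMetric m M) (h : SmoothMetric n N) {φ : M → N}
    {x : M} (hφ : MDifferentiableAt (𝓡 m) (𝓡 n) φ x) (i j : Fin m) :
    secondFundamentalForm g' h φ x i j = secondFundamentalForm g h φ x i j -
      ∑ k, (christoffel g' x (extChartAt (𝓡 m) x x) k i j
        - christoffel g x (extChartAt (𝓡 m) x x) k i j) •
          mfderiv (𝓡 m) (𝓡 n) φ x (coordVec x k) := by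
  simp only [mfderiv_coordVec hφ, Finset.smul_sum, smul_smul]
  rw [Finset.sum_comm]
  simp only [← Finset.sum_smul]
  rw [secondFundamentalForm, secondFundamentalForm, ← Finset.sum_sub_distrib]
  refine Finset.sum_congr rfl fun α _ => ?_
  rw [← sub_smul]
  congr 1
  simp only [sub_mul, Finset.sum_sub_distrib]
  ring

/-- The conformal change of the Christoffel symbols. -/
theorem christoffel_conformalMetric (g : SmoothMetric m M) (f : M → ℝ)
    (hf : ContMDiff (𝓡 m) 𝓘(ℝ, ℝ) ∞ f) (hpos : ∀ x, 0 < f x) (a : ℝ) (x : M) (k i j : Fin m) :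
    christoffel (conformalMetric g f hf hpos a) x (extChartAt (𝓡 m) x x) k i j
      - christoffel g x (extChartAt (𝓡 m) x x) k i j =
    a / (2 * f x) * ((1 : Matrix (Fin m) (Fin m) ℝ) k j * mvfderiv (𝓡 m) f x (coordVec x i)
      + (1 : Matrix (Fin m) (Fin m) ℝ) k i * mvfderiv (𝓡 m) f x (coordVec x j)
      - gram g x i j * ∑ l, (gram g x)⁻¹ k l * mvfderiv (𝓡 m) f x (coordVec x l)) := by
  set z := extChartAt (𝓡 m) x x with hz
  have hxz : (extChartAt (𝓡 m) x).symm z = x := extChartAt_to_inv x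
  have hfx := hpos x
  have hmf : MDifferentiableAt (𝓡 m) 𝓘(ℝ, ℝ) f x := (hf x).mdifferentiableAt (by simp)
  have hfd : DifferentiableAt ℝ (f ∘ (extChartAt (𝓡 m) x).symm) z := by
    have := hmf.differentiableWithinAt_writtenInExtChartAt
    rwa [ModelWithCorners.range_eq_univ, differentiableWithinAt_univ] at this
  -- Product rule, with `f ^ a` kept as a common factor so that it cancels against the inverse Gram
  -- matrix.
  have hp : ∀ i j l, pderiv i (fun y => chartGram (conformalMetric g f hf hpos a) x y j l) z =
      f x ^ a * pderiv i (fun y => chartGram g x y j l) z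
        + f x ^ a * (a / f x * mvfderiv (𝓡 m) f x (coordVec x i)) * gram g x j l := by
    intro i j l
    have h1 : HasFDerivAt (fun y => (f ∘ (extChartAt (𝓡 m) x).symm) y ^ a) _ z :=
      hfd.hasFDerivAt.rpow_const (p := a) (Or.inl (by rw [Function.comp_apply, hxz]; exact hfx.ne'))
    have h2 := h1.mul (differentiableAt_chartGram g x (mem_extChartAt_target x) j l).hasFDerivAt
    have h3 := congrArg (fun L => L (stdVec i)) h2.fderiv
    refine h3.trans ?_
    rw [mvfderiv_coordVec hmf, ← chartGram_self g x]
    simp only [add_apply, smul_apply, smul_eq_mul, Function.comp_apply, hxz, pderiv,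
      Real.rpow_sub_one hfx.ne', ← hz]
    field_simp
  have hdet : IsUnit (gram g x).det := isUnit_iff_ne_zero.2 (gram_posDef g x).det_pos.ne'
  -- Expanding the Kronecker deltas turns both sides into sums over `l` that agree term by term.
  have hone : ∀ p q, (1 : Matrix (Fin m) (Fin m) ℝ) p q = ∑ l, (gram g x)⁻¹ p l * gram g x q l := by
    intro p q
    rw [← Matrix.nonsing_inv_mul _ hdet, Matrix.mul_apply]
    exact Finset.sum_congr rfl fun l _ => by rw [gram_symm g x l q]
  have hc : (f x ^ a) ≠ 0 := (Real.rpow_pos_of_pos hfx a).ne'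
  simp only [christoffel, hp]
  rw [hz, chartGram_self, chartGram_self, inv_gram_conformalMetric, hone, hone, ← hz]
  simp only [Finset.mul_sum, Finset.sum_mul, ← Finset.sum_sub_distrib, ← Finset.sum_add_distrib,
    Matrix.smul_apply, smul_eq_mul]
  refine Finset.sum_congr rfl fun l _ => ?_
  field_simp
  ring

/-- Each Kronecker delta contributes one copy of the gradient component, and the term with `g_{ij}`
contributes `-m` copies because `g^{ij} g_{ij} = m`. -/
theorem metricTrace_christoffel_conformalMetric (g : SmoothMetric m M) (f : M → ℝ)
    (hf : ContMDiff (𝓡 m) 𝓘(ℝ, ℝ) ∞ f) (hpos : ∀ x, 0 < f x) (a : ℝ) (x : M) (k : Fin m) :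
    metricTrace g x (fun i j =>
      christoffel (conformalMetric g f hf hpos a) x (extChartAt (𝓡 m) x x) k i j
        - christoffel g x (extChartAt (𝓡 m) x x) k i j) =
    a * (2 - m) / (2 * f x) * ∑ l, (gram g x)⁻¹ k l * mvfderiv (𝓡 m) f x (coordVec x l) := by
  have hdet : IsUnit (gram g x).det := isUnit_iff_ne_zero.2 (gram_posDef g x).det_pos.ne'
  have hsymm : ∀ i j, (gram g x)⁻¹ i j = (gram g x)⁻¹ j i := fun i j =>
    ((gram_posDef g x).isHermitian.inv.apply i j).symm
  have htr : ∑ i, ∑ j, (gram g x)⁻¹ i j * gram g x i j = m := by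
    have h := congrArg Matrix.trace (Matrix.nonsing_inv_mul _ hdet)
    rw [Matrix.trace_one, Fintype.card_fin] at h
    rw [← h]
    refine Finset.sum_congr rfl fun i _ => Finset.sum_congr rfl fun j _ => ?_
    rw [gram_symm g x i j]
  set u : Fin m → ℝ := fun i => mvfderiv (𝓡 m) f x (coordVec x i) with hu
  set A := (gram g x)⁻¹ with hA
  set S := ∑ l, A k l * u l with hS
  have e1 : ∑ i, ∑ j, A i j * ((1 : Matrix (Fin m) (Fin m) ℝ) k j * u i) = S := by
    simp only [Matrix.one_apply, ite_mul, mul_ite, one_mul, zero_mul, mul_zero, Finset.sum_ite_eq,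
      Finset.mem_univ, if_true, hS]
    exact Finset.sum_congr rfl fun i _ => by rw [hsymm]
  have e2 : ∑ i, ∑ j, A i j * ((1 : Matrix (Fin m) (Fin m) ℝ) k i * u j) = S := by
    rw [Finset.sum_comm]
    simp only [Matrix.one_apply, ite_mul, mul_ite, one_mul, zero_mul, mul_zero, Finset.sum_ite_eq,
      Finset.mem_univ, if_true, hS]
  have e3 : ∑ i, ∑ j, A i j * (gram g x i j * S) = m * S := by
    rw [← htr]
    simp only [Finset.sum_mul, mul_assoc]
  have : ∀ i j, A i j * (a / (2 * f x) * ((1 : Matrix (Fin m) (Fin m) ℝ) k j * u i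
      + (1 : Matrix (Fin m) (Fin m) ℝ) k i * u j - gram g x i j * S)) =
      a / (2 * f x) * (A i j * ((1 : Matrix (Fin m) (Fin m) ℝ) k j * u i)
        + A i j * ((1 : Matrix (Fin m) (Fin m) ℝ) k i * u j) - A i j * (gram g x i j * S)) := by
    intro i j; ring
  simp only [metricTrace, christoffel_conformalMetric, smul_eq_mul]
  refine (Finset.sum_congr rfl fun i _ => Finset.sum_congr rfl fun j _ => this i j).trans ?_
  simp only [← Finset.mul_sum, Finset.sum_sub_distrib, Finset.sum_add_distrib, e1, e2, e3]
  ring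

/-- The conformal change of the tension field. -/
theorem tensionField_conformalMetric (g : SmoothMetric m M) (h : SmoothMetric n N) (f : M → ℝ)
    (hf : ContMDiff (𝓡 m) 𝓘(ℝ, ℝ) ∞ f) (hpos : ∀ x, 0 < f x) (a : ℝ) {φ : M → N} {x : M}
    (hφ : MDifferentiableAt (𝓡 m) (𝓡 n) φ x) :
    tensionField (conformalMetric g f hf hpos a) h φ x =
      (f x ^ a)⁻¹ • (tensionField g h φ x
        + (a * (m - 2) / (2 * f x)) • mfderiv (𝓡 m) (𝓡 n) φ x (grad g f x)) := by
  rw [tensionField, metricTrace_conformalMetric]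
  congr 1
  have hgrad : mfderiv (𝓡 m) (𝓡 n) φ x (grad g f x) =
      ∑ k, (∑ l, (gram g x)⁻¹ k l * mvfderiv (𝓡 m) f x (coordVec x l)) •
        mfderiv (𝓡 m) (𝓡 n) φ x (coordVec x k) := by
    simp only [grad, metricTrace, map_sum, map_smul, Finset.sum_smul, smul_smul]
  have hB : metricTrace g x (secondFundamentalForm (conformalMetric g f hf hpos a) h φ x) =
      tensionField g h φ x - ∑ k, metricTrace g x (fun i j =>
        christoffel (conformalMetric g f hf hpos a) x (extChartAt (𝓡 m) x x) k i j
          - christoffel g x (extChartAt (𝓡 m) x x) k i j) •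
            mfderiv (𝓡 m) (𝓡 n) φ x (coordVec x k) := by
    simp only [← metricTrace_smul, ← metricTrace_sum]
    rw [tensionField, ← metricTrace_sub]
    congr 1
    funext i j
    exact secondFundamentalForm_eq_sub g _ h hφ i j
  rw [hB, hgrad, sub_eq_add_neg, ← Finset.sum_neg_distrib, Finset.smul_sum]
  congr 1
  refine Finset.sum_congr rfl fun k _ => ?_
  rw [metricTrace_christoffel_conformalMetric, smul_smul, ← neg_smul]
  congr 1
  ring

theorem tensionField_conformalMetric_eq_smul_fTensionField (hm : m ≠ 2) (g : SmoothMetric m M)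
    (h : SmoothMetric n N) (f : M → ℝ) (hf : ContMDiff (𝓡 m) 𝓘(ℝ, ℝ) ∞ f) (hpos : ∀ x, 0 < f x)
    {φ : M → N} {x : M} (hφ : MDifferentiableAt (𝓡 m) (𝓡 n) φ x) :
    tensionField (conformalMetric g f hf hpos (2 / ((m : ℝ) - 2))) h φ x =
      (f x ^ (-(m : ℝ) / ((m : ℝ) - 2))) • fTensionField f g h φ x := by
  have hm' : (m : ℝ) - 2 ≠ 0 := sub_ne_zero.2 (by exact_mod_cast hm)
  have hfx := hpos x
  -- The power `-a` comes from the trace, and the extra `-1` from factoring `f⁻¹` out of `τ + f⁻¹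
  -- dφ(grad f)`.
  have he : -(m : ℝ) / ((m : ℝ) - 2) = -(2 / ((m : ℝ) - 2)) - 1 := by field_simp; ring
  have hcoef : 2 / ((m : ℝ) - 2) * (m - 2) / (2 * f x) = (f x)⁻¹ := by field_simp
  rw [tensionField_conformalMetric g h f hf hpos _ hφ, fTensionField, hcoef, he,
    Real.rpow_sub_one hfx.ne', Real.rpow_neg hfx.le, div_eq_mul_inv _ (f x), mul_smul]
  congr 1
  rw [smul_add, inv_smul_smul₀ hfx.ne']

end Tension

end FHarmonic

theorem mainTheorem8 {m n : ℕ} (hm : m ≠ 2)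
    {M : Type*} [TopologicalSpace M] [T2Space M] [SecondCountableTopology M]
    [ChartedSpace (EuclideanSpace ℝ (Fin m)) M] [IsManifold (𝓡 m) ∞ M]
    [MeasurableSpace M] [BorelSpace M]
    {N : Type*} [TopologicalSpace N] [T2Space N] [SecondCountableTopology N]
    [ChartedSpace (EuclideanSpace ℝ (Fin n)) N] [IsManifold (𝓡 n) ∞ N]
    (g : SmoothMetric m M) (h : SmoothMetric n N)
    (f : M → ℝ) (hf : ContMDiff (𝓡 m) 𝓘(ℝ, ℝ) ∞ f) (hpos : ∀ x, 0 < f x)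
    (φ : M → N) (hφ : ContMDiff (𝓡 m) (𝓡 n) ∞ φ) :
    -- harmonicity as criticality of the energies
    (IsFHarmonicMap f g h φ ↔
      IsHarmonicMap (conformalMetric g f hf hpos (2 / ((m : ℝ) - 2))) h φ) ∧
    -- the identity between the tension fields
    (∀ x, tensionField (conformalMetric g f hf hpos (2 / ((m : ℝ) - 2))) h φ x =
      (f x ^ (-(m : ℝ) / ((m : ℝ) - 2))) • fTensionField f g h φ x) ∧
    -- harmonicity as vanishing of the tension fields
    ((∀ x, fTensionField f g h φ x = 0) ↔
      ∀ x, tensionField (conformalMetric g f hf hpos (2 / ((m : ℝ) - 2))) h φ x = 0) := by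
  have hT : ∀ x, tensionField (conformalMetric g f hf hpos (2 / ((m : ℝ) - 2))) h φ x =
      (f x ^ (-(m : ℝ) / ((m : ℝ) - 2))) • fTensionField f g h φ x := fun x =>
    tensionField_conformalMetric_eq_smul_fTensionField hm g h f hf hpos
      ((hφ x).mdifferentiableAt (by simp))
  refine ⟨?_, hT, ?_⟩
  -- On each compact domain the two functionals are the same function of the map, so they have the
  -- same derivative along every variation.
  · refine forall₂_congr fun Ω hΩ => ?_
    have hE : ∀ ψ : M → N, energy (conformalMetric g f hf hpos (2 / ((m : ℝ) - 2))) h ψ Ω =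
        fEnergy f g h ψ Ω := fun ψ =>
      energy_conformalMetric hm g h f hf hpos ψ hΩ.1.isClosed.measurableSet
    simp only [hE]
  · refine forall_congr' fun x => ?_
    rw [hT x, smul_eq_zero_iff_right (Real.rpow_pos_of_pos (hpos x) _).ne']
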